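/- **Theorem 1.2.** Let $k\in[0,1)$ and let $n\ge 1$ be an integer with $$n\le N(k):=\frac{1-2k+\sqrt{4k^2-4k+8}}{2(1-k)},\qquad p=p_1(n,k):=1+\frac{2}{(1-k)n}.$$ Let $R>0$, and let $u_0\in H^1(\mathbb R^n)$ and $u_1\in L^2(\mathbb R^n)$ be real-valued, nonnegative and nontrivial (each of the two is nonnegative a.e. and not a.e. zero), with supports contained in the ball $B_R$ of radius $R$ around the origin. For $\varepsilon>0$ consider the Cauchy problem $$u_{tt}-t^{-2k}\Delta u=t^{1-p}|u|^p\quad (x\in\mathbb R^n,\ t\in(1,T)),\qquad u(1,x)=\varepsilon u_0(x),\quad u_t(1,x)=\varepsilon u_1(x).\tag{1}$$ For $1<T\le\infty$, an *energy solution* of (1) on $[1,T)$ is a real-valued function $$u\in C([1,T),H^1(\mathbb R^n))\cap C^1([1,T),L^2(\mathbb R^n))\cap L^p_{\mathrm{loc}}([1,T)\times\mathbb R^n)$$ with $u(1,\cdot)=\varepsilon u_0$ in $H^1(\mathbb R^n)$ such that $$\int_{\mathbb R^n}\partial_tu(t,x)\psi(t,x)\,dx-\varepsilon\int_{\mathbb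 R^n}u_1(x)\psi(1,x)\,dx-\int_1^t\!\int_{\mathbb R^n}\big(\partial_tu(s,x)\,\psi_s(s,x)-s^{-2k}\nabla u(s,x)\cdot\nabla\psi(s,x)\big)dx\,ds=\int_1^t\!\int_{\mathbb R^n}s^{1-p}|u(s,x)|^p\psi(s,x)\,dx\,ds$$ for all $\psi\in C_0^\infty([1,T)\times\mathbb R^n)$ (not required to vanish at $t=1$) and all $t\in(1,T)$. Only energy solutions satisfying the support condition $$\operatorname{supp}u(t,\cdot)\subset B_{A_k(t)+R}\quad\text{for all }t\in(1,T),\qquad A_k(t):=\int_1^t\tau^{-k}\,d\tau,\tag{2}$$ are considered. The *lifespan* $T(\varepsilon)\in[-\infty,\infty]$ is the supremum of all $T\in(1,\infty]$ for which an energy solution of (1) on $[1,T)$ satisfying (2) exists (with $\sup\emptyset=-\infty$). Then there exist constants $\varepsilon_0>0$ and $C>0$, which may depend on $u_0,u_1,n,p,k,R$ but not on $\varepsilon$, $T$ or the solution, such that for every $\varepsilon\in(0,\varepsilon_0]$ every energy solution of (1) satisfying (2) blows up in finite time, that is, whenever such a solution exists on $[1,T)$ one has $T<\infty$, and moreover $$T\le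 \exp\big(C\varepsilon^{-(p-1)}\big),\qquad\text{so that also}\qquad T(\varepsilon)\le \exp\big(C\varepsilon^{-(p-1)}\big).$$ -/

import Mathlib

open MeasureTheory Set
open scoped ENNReal ContDiff Gradient

noncomputable section

namespace EdeS

/-- Euclidean space `ℝⁿ`. -/
abbrev Space (n : ℕ) : Type := EuclideanSpace ℝ (Fin n)

/-- The space `L²(ℝⁿ)` of real-valued functions. -/
abbrev L2 (n : ℕ) : Type := Lp ℝ 2 (volume : Measure (Space n))

/-- The space `L²(ℝⁿ; ℝⁿ)` of square integrable vector fields. -/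
abbrev L2Vec (n : ℕ) : Type := Lp (Space n) 2 (volume : Measure (Space n))

/-- `g` is the weak (distributional) gradient of `f`:
`∫ f ∂ᵢφ dx = - ∫ gᵢ φ dx` for every `φ ∈ C_c^∞(ℝⁿ)` and every `i`. -/
def IsWeakGradient {n : ℕ} (f : L2 n) (g : L2Vec n) : Prop :=
  ∀ φ : Space n → ℝ, ContDiff ℝ ∞ φ → HasCompactSupport φ → ∀ i : Fin n,
    ∫ x, f x * fderiv ℝ φ x (EuclideanSpace.single i 1) = - ∫ x, g x i * φ x

lemma integrable_mul_test {n : ℕ} {f : Space n → ℝ} (hf : MemLp f 2 volume)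
    {φ : Space n → ℝ} (hφ : Continuous φ) (hc : HasCompactSupport φ) :
    Integrable (fun x => f x * φ x) volume :=
  MemLp.integrable_mul (p := 2) (q := 2) hf (hφ.memLp_of_hasCompactSupport hc)

lemma memLp_coord {n : ℕ} (g : L2Vec n) (i : Fin n) :
    MemLp (fun x => g x i) 2 (volume : Measure (Space n)) :=
  (EuclideanSpace.proj i : Space n →L[ℝ] ℝ).comp_memLp' (Lp.memLp g)

lemma continuous_partial {n : ℕ} {φ : Space n → ℝ} (hφ : ContDiff ℝ ∞ φ) (i : Fin n) :
    Continuous fun x => fderiv ℝ φ x (EuclideanSpace.single i 1) :=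
  (hφ.continuous_fderiv (by simp)).clm_apply continuous_const

lemma hasCompactSupport_partial {n : ℕ} {φ : Space n → ℝ} (hc : HasCompactSupport φ)
    (i : Fin n) :
    HasCompactSupport fun x => fderiv ℝ φ x (EuclideanSpace.single i 1) :=
  hc.fderiv_apply ℝ (EuclideanSpace.single i 1)

/-- The space `H¹(ℝⁿ)` realised as the space of pairs `(f, ∇f)` in
`L²(ℝⁿ) × L²(ℝⁿ; ℝⁿ)` for which `∇f` is the weak gradient of `f`.  It carries the norm
`‖f‖² = ‖f‖²_{L²} + ‖∇f‖²_{L²}`. -/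
def H1Submodule (n : ℕ) : Submodule ℝ (WithLp 2 (L2 n × L2Vec n)) where
  carrier := {q | IsWeakGradient q.fst q.snd}
  zero_mem' := by
    intro φ _ _ i
    have h1 : ∫ x, (0 : L2 n) x * fderiv ℝ φ x (EuclideanSpace.single i 1) = 0 := by
      refine integral_eq_zero_of_ae ?_
      filter_upwards [Lp.coeFn_zero ℝ 2 (volume : Measure (Space n))] with x hx
      rw [hx]
      simp
    have h2 : ∫ x, (0 : L2Vec n) x i * φ x = 0 := by
      refine integral_eq_zero_of_ae ?_
      filter_upwards [Lp.coeFn_zero (Space n) 2 (volume : Measure (Space n))] with x hx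
      rw [hx]
      simp
    change ∫ x, (0 : L2 n) x * fderiv ℝ φ x (EuclideanSpace.single i 1)
      = - ∫ x, (0 : L2Vec n) x i * φ x
    rw [h1, h2, neg_zero]
  add_mem' := by
    intro a b ha hb φ hφ hc i
    have hp := continuous_partial hφ i
    have hpc := hasCompactSupport_partial hc i
    have h1 : ∫ x, (a.fst + b.fst : L2 n) x * fderiv ℝ φ x (EuclideanSpace.single i 1)
        = (∫ x, a.fst x * fderiv ℝ φ x (EuclideanSpace.single i 1))
          + ∫ x, b.fst x * fderiv ℝ φ x (EuclideanSpace.single i 1) := by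
      rw [← integral_add (integrable_mul_test (Lp.memLp a.fst) hp hpc)
        (integrable_mul_test (Lp.memLp b.fst) hp hpc)]
      refine integral_congr_ae ?_
      filter_upwards [Lp.coeFn_add a.fst b.fst] with x hx
      rw [hx]
      exact add_mul _ _ _
    have h2 : ∫ x, (a.snd + b.snd : L2Vec n) x i * φ x
        = (∫ x, a.snd x i * φ x) + ∫ x, b.snd x i * φ x := by
      rw [← integral_add (integrable_mul_test (memLp_coord a.snd i) hφ.continuous hc)
        (integrable_mul_test (memLp_coord b.snd i) hφ.continuous hc)]
      refine integral_congr_ae ?_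
      filter_upwards [Lp.coeFn_add a.snd b.snd] with x hx
      rw [hx]
      exact add_mul _ _ _
    have ha' := ha φ hφ hc i
    have hb' := hb φ hφ hc i
    change ∫ x, (a.fst + b.fst : L2 n) x * fderiv ℝ φ x (EuclideanSpace.single i 1)
      = - ∫ x, (a.snd + b.snd : L2Vec n) x i * φ x
    rw [h1, h2, ha', hb']
    ring
  smul_mem' := by
    intro c a ha φ hφ hc i
    have h1 : ∫ x, (c • a.fst : L2 n) x * fderiv ℝ φ x (EuclideanSpace.single i 1)
        = c * ∫ x, a.fst x * fderiv ℝ φ x (EuclideanSpace.single i 1) := by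
      rw [← integral_const_mul]
      refine integral_congr_ae ?_
      filter_upwards [Lp.coeFn_smul c a.fst] with x hx
      simp [hx, mul_assoc]
    have h2 : ∫ x, (c • a.snd : L2Vec n) x i * φ x = c * ∫ x, a.snd x i * φ x := by
      rw [← integral_const_mul]
      refine integral_congr_ae ?_
      filter_upwards [Lp.coeFn_smul c a.snd] with x hx
      simp [hx, mul_assoc]
    have ha' := ha φ hφ hc i
    change ∫ x, (c • a.fst : L2 n) x * fderiv ℝ φ x (EuclideanSpace.single i 1)
      = - ∫ x, (c • a.snd : L2Vec n) x i * φ x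
    rw [h1, h2, ha']
    ring

/-- The Sobolev space `H¹(ℝⁿ)`, a real normed space. -/
abbrev H1 (n : ℕ) : Type := H1Submodule n

/-- The underlying `L²` function of an element of `H¹`. -/
def H1.fn {n : ℕ} (f : H1 n) : L2 n := f.1.fst

/-- The weak gradient of an element of `H¹`. -/
def H1.grad {n : ℕ} (f : H1 n) : L2Vec n := f.1.snd

/-- The amplitude of the light cone, `A_k(t) = ∫₁ᵗ τ^{-k} dτ`. -/
def A (k t : ℝ) : ℝ := ∫ τ in (1 : ℝ)..t, τ ^ (-k)

/-- The dimension threshold `N(k) = (1 - 2k + √(4k² - 4k + 8)) / (2(1 - k))`. -/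
def N (k : ℝ) : ℝ := (1 - 2 * k + √(4 * k ^ 2 - 4 * k + 8)) / (2 * (1 - k))

/-- The critical exponent `p₁(n,k) = 1 + 2 / ((1 - k) n)`. -/
def p₁ (n : ℕ) (k : ℝ) : ℝ := 1 + 2 / ((1 - k) * n)

/-- `supp f ⊂ B_r` for (a class of) a measurable function: `f` vanishes almost everywhere outside
the ball of radius `r` around the origin (spheres are null sets, so the open and the closed
ball give the same condition). -/
def SupportedInBall {n : ℕ} (f : L2 n) (r : ℝ) : Prop :=
  ∀ᵐ x : Space n, r < ‖x‖ → f x = 0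

/-- The time interval `[1, T)`, where `T = ∞` is allowed. -/
def timeInterval (T : EReal) : Set ℝ := {t | 1 ≤ t ∧ (t : EReal) < T}

/-- The derivative `∂ₜu` of a curve `[1, T) → H¹`, taken in `L²`. -/
def timeDeriv {n : ℕ} (T : EReal) (u : ℝ → H1 n) (t : ℝ) : L2 n :=
  derivWithin (fun s => (u s).fn) (timeInterval T) t

/-- `u ∈ L^p_loc([1, T) × ℝⁿ)`: the curve `u` is represented by a function of `(t, x)` whose
`p`-th power is integrable over the compact subsets of `[1, T) × ℝⁿ`. -/
def MemLpLoc {n : ℕ} (p : ℝ) (T : EReal) (u : ℝ → H1 n) : Prop :=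
  ∃ U : ℝ × Space n → ℝ,
    (∀ᵐ t : ℝ, t ∈ timeInterval T → (fun x => U (t, x)) =ᵐ[volume] (u t).fn) ∧
    ∀ K : Set (ℝ × Space n), IsCompact K → K ⊆ timeInterval T ×ˢ univ →
      MemLp U (ENNReal.ofReal p) (volume.restrict K)

/-- Test functions `ψ ∈ C_0^∞([1, T) × ℝⁿ)`: restrictions to times `t ≥ 1` of smooth functions
on space-time whose support is compact and contained in `{t < T}`.  They need not vanish at
`t = 1`. -/
structure IsTestFunction {n : ℕ} (T : EReal) (ψ : ℝ × Space n → ℝ) : Prop where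
  smooth : ContDiff ℝ ∞ ψ
  compact : HasCompactSupport ψ
  support : ∀ z ∈ tsupport ψ, (z.1 : EReal) < T

/-- `u` is an energy solution on `[1, T)`, `1 < T ≤ ∞`, of the Cauchy problem
`u_tt - t^{-2k} Δu = t^{1-p} |u|^p`, `u(1,·) = ε u₀`, `u_t(1,·) = ε u₁`. Only the values of the
curve `u` on `[1, T)` matter. -/
structure IsEnergySolution {n : ℕ} (k p ε : ℝ) (u₀ : H1 n) (u₁ : L2 n) (T : EReal)
    (u : ℝ → H1 n) : Prop where
  one_lt : 1 < T
  /-- `u ∈ C([1,T), H¹(ℝⁿ))` -/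
  continuous_H1 : ContinuousOn u (timeInterval T)
  /-- `u ∈ C¹([1,T), L²(ℝⁿ))` -/
  contDiff_L2 : ContDiffOn ℝ 1 (fun t => (u t).fn) (timeInterval T)
  /-- `u ∈ L^p_loc([1,T) × ℝⁿ)` -/
  memLpLoc : MemLpLoc p T u
  /-- `u(1,·) = ε u₀` in `H¹(ℝⁿ)` -/
  initial : u 1 = ε • u₀
  /-- the integral relation -/
  integral_eq : ∀ ψ : ℝ × Space n → ℝ, IsTestFunction T ψ →
    ∀ t : ℝ, 1 < t → (t : EReal) < T →
      (∫ x, timeDeriv T u t x * ψ (t, x)) - ε * (∫ x, u₁ x * ψ (1, x))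
        - (∫ s in (1 : ℝ)..t, ∫ x,
            (timeDeriv T u s x * deriv (fun r => ψ (r, x)) s
              - s ^ (-2 * k) * inner ℝ ((u s).grad x) (∇ (fun y => ψ (s, y)) x)))
      = ∫ s in (1 : ℝ)..t, ∫ x, s ^ (1 - p) * |(u s).fn x| ^ p * ψ (s, x)

/-- The support condition `supp u(t,·) ⊂ B_{A_k(t)+R}` for all `t ∈ (1, T)`. -/
def HasConeSupport {n : ℕ} (k R : ℝ) (T : EReal) (u : ℝ → H1 n) : Prop :=
  ∀ t : ℝ, 1 < t → (t : EReal) < T → SupportedInBall (u t).fn (A k t + R)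

/-- The lifespan `T(ε)`: the maximal existence time of energy solutions with the support
condition, i.e. the supremum of all `T ∈ (1, ∞]` such that one exists on `[1, T)`. -/
def lifespan {n : ℕ} (k p R : ℝ) (u₀ : H1 n) (u₁ : L2 n) (ε : ℝ) : EReal :=
  sSup {T | ∃ u : ℝ → H1 n, IsEnergySolution k p ε u₀ u₁ T u ∧ HasConeSupport k R T u}

end EdeS

end

/-!
Test the equation with `ψ(t, x) = η(t) φ(x)`, where `φ = 1` on the cone `‖x‖ ≤ A_k(t) + R` for
`t ≤ B` and `η` falls from one to zero in the variable `log t / log B`. The gradient term vanishes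
by the support condition, so `F(t) = ∫ u(t, x) dx` and `h(t) = t^{1-p} ∫ |u(t, x)|^p dx` satisfy
`ε ∫ u₁ + ∫ η h dt = ∫ F η'' dt` over `[1, B]`.
The cone has volume at most a multiple of `t^{(1-k)n}`, and `p` is critical because this makes
Hölder's inequality read `h ≥ c t^{-1-p} |F|^p`. Together with `|η''| ≤ K η^{1/p} / (t² log B)`
and Young's inequality, the right-hand side is at most `∫ η h dt + C (log B)^{-1/(p-1)}`. Hence
`log B ≤ C ε^{-(p-1)}` for every `B` below the existence time.
-/

namespace EdeS

open scoped Topology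

section LogCutoff

/-- `η` is a logarithmic cut-off of the time interval `[1, B]`, adapted to the exponent `p`: in the
variable `log t / log B` it falls smoothly from one to zero. The bound on the second derivative is
the one needed in the test function method, where `η ^ p⁻¹` is absorbed by the nonlinearity. -/
structure IsLogCutoff (p K B : ℝ) (η : ℝ → ℝ) : Prop where
  contDiff : ContDiff ℝ ∞ η
  nonneg : ∀ t, 0 ≤ η t
  eventuallyEq_one : η =ᶠ[𝓝 1] 1
  eq_zero : ∀ t, B ≤ |t| → η t = 0
  abs_deriv_deriv_le : ∀ t, 1 ≤ t →
    |deriv (deriv η) t| ≤ K * η t ^ p⁻¹ / (t ^ 2 * Real.log B)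

lemma IsLogCutoff.deriv_one {p K B : ℝ} {η : ℝ → ℝ} (hη : IsLogCutoff p K B η) :
    deriv η 1 = 0 := by
  rw [hη.eventuallyEq_one.deriv_eq, Pi.one_def, deriv_const]

lemma IsLogCutoff.deriv_right {p K B : ℝ} {η : ℝ → ℝ} (hη : IsLogCutoff p K B η) :
    deriv η B = 0 := by
  have hmin : IsLocalMin η B := Filter.Eventually.of_forall fun t =>
    (hη.eq_zero B (le_abs_self B)).trans_le (hη.nonneg t)
  exact hmin.deriv_eq_zero

lemma IsLogCutoff.abs_le_of_mem_tsupport {p K B t : ℝ} {η : ℝ → ℝ} (hη : IsLogCutoff p K B η)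
    (ht : t ∈ tsupport η) : |t| ≤ B := by
  refine closure_minimal (t := {t : ℝ | |t| ≤ B}) (fun s hs => ?_)
    (isClosed_le continuous_abs continuous_const) ht
  by_contra h
  exact hs (hη.eq_zero s (not_le.1 h).le)

lemma IsLogCutoff.hasCompactSupport {p K B : ℝ} {η : ℝ → ℝ} (hη : IsLogCutoff p K B η) :
    HasCompactSupport η :=
  HasCompactSupport.intro (isCompact_Icc (a := -B) (b := B)) fun t ht =>
    hη.eq_zero t (by rw [mem_Icc, ← abs_le] at ht; exact (not_le.1 ht).le)

lemma exists_abs_deriv_pow_le {ζ : ℝ → ℝ} (hζ : ContDiff ℝ 2 ζ)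
    (hc : HasCompactSupport (deriv ζ)) (h0 : ∀ x, 0 ≤ ζ x) (h1 : ∀ x, ζ x ≤ 1) (m : ℕ) :
    ∃ K, ∀ x, |deriv (ζ ^ (m + 2)) x| ≤ K * ζ x ^ m ∧
      |deriv (deriv (ζ ^ (m + 2))) x| ≤ K * ζ x ^ m := by
  have hζ' : ContDiff ℝ 1 (deriv ζ) := hζ.deriv'
  obtain ⟨K₁, hK₁⟩ := hζ'.continuous.bounded_above_of_compact_support hc
  obtain ⟨K₂, hK₂⟩ := (hζ'.continuous_deriv le_rfl).bounded_above_of_compact_support hc.deriv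
  simp only [Real.norm_eq_abs] at hK₁ hK₂
  have hd : ∀ x, HasDerivAt ζ (deriv ζ x) x := fun x =>
    (hζ.differentiable two_ne_zero x).hasDerivAt
  have hd' : ∀ x, HasDerivAt (deriv ζ) (deriv (deriv ζ) x) x := fun x =>
    (hζ'.differentiable one_ne_zero x).hasDerivAt
  have hderiv : deriv (ζ ^ (m + 2)) = fun x => (m + 2) * (ζ x ^ (m + 1) * deriv ζ x) := by
    funext x
    rw [((hd x).pow (m + 2)).deriv]
    push_cast
    ring_nf
  have hderiv₂ : ∀ x, deriv (deriv (ζ ^ (m + 2))) x =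
      (m + 2) * (ζ x * deriv (deriv ζ) x + (m + 1) * deriv ζ x ^ 2) * ζ x ^ m := by
    intro x
    rw [hderiv, ((((hd x).fun_pow (m + 1)).fun_mul (hd' x)).const_mul _).deriv]
    push_cast
    ring_nf
  refine ⟨(m + 2) * max K₁ (K₂ + (m + 1) * K₁ ^ 2), fun x => ⟨?_, ?_⟩⟩
  · have hK : |ζ x * deriv ζ x| ≤ K₁ := by
      rw [abs_mul, abs_of_nonneg (h0 x)]
      exact (mul_le_of_le_one_left (abs_nonneg _) (h1 x)).trans (hK₁ x)
    have hm := pow_nonneg (h0 x) m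
    calc |deriv (ζ ^ (m + 2)) x| = (m + 2) * |ζ x * deriv ζ x| * ζ x ^ m := by
          rw [congrFun hderiv x, abs_mul, pow_succ, mul_assoc, abs_mul (ζ x ^ m),
            abs_of_nonneg hm, abs_of_nonneg (by positivity)]
          ring
      _ ≤ _ := by gcongr; exact hK.trans (le_max_left _ _)
  · have hK : |ζ x * deriv (deriv ζ) x + (m + 1) * deriv ζ x ^ 2| ≤ K₂ + (m + 1) * K₁ ^ 2 := by
      refine (abs_add_le _ _).trans (add_le_add ?_ ?_)
      · rw [abs_mul, abs_of_nonneg (h0 x)]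
        exact (mul_le_of_le_one_left (abs_nonneg _) (h1 x)).trans (hK₂ x)
      · rw [abs_of_nonneg (by positivity), ← sq_abs]
        gcongr
        exact hK₁ x
    have hm := pow_nonneg (h0 x) m
    rw [hderiv₂, abs_mul, abs_of_nonneg hm, abs_mul, abs_of_nonneg (by positivity)]
    gcongr
    exact hK.trans (le_max_right _ _)

/-- A smooth cut-off profile, equal to one on `(-∞, 1/2]` and to zero on `[1, ∞)`. -/
noncomputable def smoothStep (x : ℝ) : ℝ := Real.smoothTransition (2 - 2 * x)

lemma smoothStep_nonneg (x : ℝ) : 0 ≤ smoothStep x := Real.smoothTransition.nonneg _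

lemma smoothStep_le_one (x : ℝ) : smoothStep x ≤ 1 := Real.smoothTransition.le_one _

lemma smoothStep_of_le_half {x : ℝ} (hx : x ≤ 1 / 2) : smoothStep x = 1 :=
  Real.smoothTransition.one_of_one_le (by linarith)

lemma smoothStep_of_one_le {x : ℝ} (hx : 1 ≤ x) : smoothStep x = 0 :=
  Real.smoothTransition.zero_of_nonpos (by linarith)

lemma contDiff_smoothStep : ContDiff ℝ ∞ smoothStep :=
  Real.smoothTransition.contDiff.comp (contDiff_const.sub (contDiff_const.mul contDiff_id))

lemma hasCompactSupport_deriv_smoothStep : HasCompactSupport (deriv smoothStep) := by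
  refine HasCompactSupport.intro (isCompact_Icc (a := 1 / 2) (b := 1)) fun x hx => ?_
  rw [mem_Icc, not_and_or, not_le, not_le] at hx
  rcases hx with hx | hx
  · have h : smoothStep =ᶠ[𝓝 x] fun _ => 1 := by
      filter_upwards [Iio_mem_nhds hx] with y hy using smoothStep_of_le_half (le_of_lt hy)
    rw [h.deriv_eq, deriv_const]
  · have h : smoothStep =ᶠ[𝓝 x] fun _ => 0 := by
      filter_upwards [Ioi_mem_nhds hx] with y hy using smoothStep_of_one_le (le_of_lt hy)
    rw [h.deriv_eq, deriv_const]

lemma contDiff_comp_log_div {χ : ℝ → ℝ} {a L : ℝ} (hχ : ContDiff ℝ ∞ χ)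
    (hχa : ∀ x ≤ 0, χ x = a) (hL : 0 ≤ L) : ContDiff ℝ ∞ fun t => χ (Real.log t / L) := by
  refine contDiff_iff_contDiffAt.2 fun t => ?_
  rcases eq_or_ne t 0 with rfl | ht
  · -- `Real.log t` is `log |t|`, so the composition is constant on `[-1, 1]`.
    have h : (fun t => χ (Real.log t / L)) =ᶠ[𝓝 0] fun _ => a := by
      filter_upwards [Metric.closedBall_mem_nhds (0 : ℝ) one_pos] with t ht
      rw [mem_closedBall_zero_iff, Real.norm_eq_abs] at ht
      refine hχa _ (div_nonpos_of_nonpos_of_nonneg ?_ hL)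
      rw [← Real.log_abs]
      exact Real.log_nonpos (abs_nonneg t) ht
    exact contDiffAt_const.congr_of_eventuallyEq h
  · exact hχ.contDiffAt.comp t ((Real.contDiffAt_log.2 ht).div_const L)

lemma deriv_deriv_comp_log_div {χ : ℝ → ℝ} {L t : ℝ} (hχ : ContDiff ℝ 2 χ) (hL : L ≠ 0)
    (ht : t ≠ 0) : deriv (deriv fun s => χ (Real.log s / L)) t =
      (deriv (deriv χ) (Real.log t / L) / L - deriv χ (Real.log t / L)) / (t ^ 2 * L) := by
  have hlog : ∀ s ≠ 0, HasDerivAt (fun s => Real.log s / L) (s⁻¹ / L) s := fun s hs =>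
    (Real.hasDerivAt_log hs).div_const L
  have hderiv : deriv (fun s => χ (Real.log s / L)) =ᶠ[𝓝 t]
      fun s => deriv χ (Real.log s / L) * (s⁻¹ / L) := by
    filter_upwards [isOpen_ne.mem_nhds ht] with s hs
    exact ((hχ.differentiable two_ne_zero _).hasDerivAt.comp s (hlog s hs)).deriv
  have hχ' : Differentiable ℝ (deriv χ) := (hχ.deriv' (n := 1)).differentiable one_ne_zero
  have hcomp : HasDerivAt (fun s => deriv χ (Real.log s / L))
      (deriv (deriv χ) (Real.log t / L) * (t⁻¹ / L)) t :=
    (hχ' _).hasDerivAt.comp t (hlog t ht)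
  rw [hderiv.deriv_eq, (hcomp.fun_mul ((hasDerivAt_inv ht).div_const L)).deriv]
  field_simp
  ring

lemma pow_le_pow_add_two_rpow_inv {x p : ℝ} {m : ℕ} (hx0 : 0 ≤ x) (hx1 : x ≤ 1) (hp : 1 < p)
    (hm : 2 / (p - 1) ≤ m) : x ^ m ≤ (x ^ (m + 2)) ^ p⁻¹ := by
  have hmp : ((m + 2 : ℕ) : ℝ) * p⁻¹ ≤ m := by
    rw [div_le_iff₀ (by linarith)] at hm
    rw [← div_eq_mul_inv, div_le_iff₀ (by linarith)]
    push_cast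
    linarith
  rw [← Real.rpow_natCast, ← Real.rpow_natCast, ← Real.rpow_mul hx0]
  exact Real.rpow_le_rpow_of_exponent_ge' hx0 hx1 (by positivity) hmp

lemma exists_isLogCutoff {p : ℝ} (hp : 1 < p) :
    ∃ K > 0, ∀ B, Real.exp 1 ≤ B → ∃ η, IsLogCutoff p K B η := by
  obtain ⟨m, hm⟩ := exists_nat_ge (2 / (p - 1))
  obtain ⟨K, hK⟩ := exists_abs_deriv_pow_le (contDiff_infty.1 contDiff_smoothStep 2)
    hasCompactSupport_deriv_smoothStep smoothStep_nonneg smoothStep_le_one m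
  set χ : ℝ → ℝ := smoothStep ^ (m + 2) with hχdef
  have hχ : ContDiff ℝ ∞ χ := contDiff_smoothStep.pow (m + 2)
  have hχ_half : ∀ x ≤ 1 / 2, χ x = 1 := fun x hx => by
    rw [hχdef, Pi.pow_apply, smoothStep_of_le_half hx, one_pow]
  refine ⟨2 * max K 1, by positivity, fun B hB => ⟨fun t => χ (Real.log t / Real.log B), ?_⟩⟩
  have hB0 : 0 < B := (Real.exp_pos 1).trans_le hB
  have hL : 1 ≤ Real.log B := (Real.le_log_iff_exp_le hB0).2 hB
  have hL0 : 0 < Real.log B := zero_lt_one.trans_le hL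
  refine ⟨contDiff_comp_log_div hχ (fun x hx => hχ_half x (by linarith)) hL0.le,
    fun t => pow_nonneg (smoothStep_nonneg _) _, ?_, fun t ht => ?_, fun t ht => ?_⟩
  · have hlog : ContinuousAt (fun t => Real.log t / Real.log B) 1 :=
      (Real.continuousAt_log one_ne_zero).div_const _
    filter_upwards [hlog.eventually_lt_const (u := 1 / 2) (by simp)] with t ht using hχ_half _ ht.le
  · have h : 1 ≤ Real.log t / Real.log B := by
      rw [one_le_div hL0, ← Real.log_abs t]
      exact Real.log_le_log hB0 ht
    rw [hχdef, Pi.pow_apply, smoothStep_of_one_le h, zero_pow (by lia)]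
  · set x := Real.log t / Real.log B
    rw [deriv_deriv_comp_log_div (contDiff_infty.1 hχ 2) hL0.ne' (by positivity), abs_div,
      abs_of_pos (by positivity : 0 < t ^ 2 * Real.log B)]
    gcongr
    calc |deriv (deriv χ) x / Real.log B - deriv χ x|
        ≤ |deriv (deriv χ) x| + |deriv χ x| := by
          refine (abs_sub _ _).trans (add_le_add_left ?_ _)
          rw [abs_div, abs_of_pos hL0]
          exact div_le_self (abs_nonneg _) hL
      _ ≤ K * smoothStep x ^ m + K * smoothStep x ^ m := add_le_add (hK x).2 (hK x).1
      _ ≤ 2 * max K 1 * smoothStep x ^ m := by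
          rw [← two_mul, mul_assoc 2]
          have := pow_nonneg (smoothStep_nonneg x) m
          gcongr
          exact le_max_left _ _
      _ ≤ 2 * max K 1 * χ x ^ p⁻¹ := by
          gcongr
          exact pow_le_pow_add_two_rpow_inv (smoothStep_nonneg x) (smoothStep_le_one x) hp hm

end LogCutoff

section LogBound

lemma exists_mul_le_rpow_add_rpow {p q c : ℝ} (hpq : p.HolderConjugate q) (hc : 0 < c) :
    ∃ C > 0, ∀ x y : ℝ, 0 ≤ x → 0 ≤ y → x * y ≤ c * x ^ p + C * y ^ q := by
  have hp := hpq.pos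
  have hq := hpq.symm.pos
  set δ := (c * p) ^ p⁻¹
  have hδ0 : 0 < δ := by positivity
  have hδp : δ ^ p = c * p := Real.rpow_inv_rpow (by positivity) hp.ne'
  refine ⟨(δ ^ q * q)⁻¹, by positivity, fun x y hx hy => ?_⟩
  calc x * y = (δ * x) * (y / δ) := by field_simp
    _ ≤ (δ * x) ^ p / p + (y / δ) ^ q / q :=
        Real.young_inequality_of_nonneg (by positivity) (by positivity) hpq
    _ = c * x ^ p + (δ ^ q * q)⁻¹ * y ^ q := by
        rw [Real.mul_rpow hδ0.le hx, hδp, Real.div_rpow hy hδ0.le]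
        field_simp

lemma exists_mul_deriv_deriv_le {p q K M : ℝ} (hpq : p.HolderConjugate q) (hK : 0 < K)
    (hM : 0 < M) :
    ∃ C > 0, ∀ B η, 1 ≤ B → IsLogCutoff p K B η → ∀ t F h : ℝ, 1 ≤ t →
      t ^ (-1 - p) * |F| ^ p ≤ M * h →
        F * deriv (deriv η) t ≤ η t * h + C * Real.log B ^ (-q) * t⁻¹ := by
  have hp := hpq.pos
  obtain ⟨C, hC, hyoung⟩ := exists_mul_le_rpow_add_rpow hpq (inv_pos.2 hM)
  refine ⟨C * K ^ q, by positivity, fun B η hB hη t F h ht hFh => ?_⟩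
  have ht0 : 0 < t := by positivity
  have hL := Real.log_nonneg hB
  have hη0 := hη.nonneg t
  -- Split `t⁻²` so that the `p`-th power of the first factor is `t ^ (-1 - p) * |F| ^ p * η t`.
  set x := t ^ ((-1 - p) / p) * |F| * η t ^ p⁻¹ with hx
  set y := K * t ^ (-q⁻¹) * (Real.log B)⁻¹ with hy
  have hxp : x ^ p = t ^ (-1 - p) * |F| ^ p * η t := by
    rw [hx, Real.mul_rpow (by positivity) (by positivity), Real.mul_rpow (by positivity)
      (abs_nonneg F), ← Real.rpow_mul ht0.le, div_mul_cancel₀ _ hp.ne',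
      Real.rpow_inv_rpow hη0 hp.ne']
  have hyq : y ^ q = K ^ q * Real.log B ^ (-q) * t⁻¹ := by
    rw [hy, Real.mul_rpow (by positivity) (by positivity), Real.mul_rpow hK.le (by positivity),
      ← Real.rpow_mul ht0.le, neg_mul, inv_mul_cancel₀ hpq.symm.ne_zero, Real.rpow_neg_one,
      Real.inv_rpow hL, Real.rpow_neg hL]
    ring
  have hexp : t ^ ((-1 - p) / p) * t ^ (-q⁻¹) = (t ^ 2)⁻¹ := by
    rw [← Real.rpow_add ht0, ← Real.rpow_natCast, ← Real.rpow_neg ht0.le]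
    congr 1
    push_cast
    linear_combination (-1) * hpq.inv_add_inv_eq_one - mul_inv_cancel₀ hp.ne'
  calc F * deriv (deriv η) t ≤ |F| * |deriv (deriv η) t| := (le_abs_self _).trans_eq (abs_mul _ _)
    _ ≤ |F| * (K * η t ^ p⁻¹ / (t ^ 2 * Real.log B)) := by
        gcongr
        exact hη.abs_deriv_deriv_le t ht
    _ = |F| * η t ^ p⁻¹ * K * (Real.log B)⁻¹ * (t ^ 2)⁻¹ := by rw [div_eq_mul_inv, mul_inv]; ring
    _ = x * y := by rw [← hexp, hx, hy]; ring
    _ ≤ M⁻¹ * x ^ p + C * y ^ q := hyoung x y (by positivity) (by positivity)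
    _ = η t * (M⁻¹ * (t ^ (-1 - p) * |F| ^ p)) + C * K ^ q * Real.log B ^ (-q) * t⁻¹ := by
        rw [hxp, hyq]; ring
    _ ≤ η t * h + C * K ^ q * Real.log B ^ (-q) * t⁻¹ := by
        gcongr
        rwa [inv_mul_le_iff₀ hM]

lemma le_rpow_of_mul_le_mul_rpow {p q a c L : ℝ} (hpq : p.HolderConjugate q) (ha : 0 < a)
    (hL : 0 < L) (h : a ≤ c * L ^ (1 - q)) : L ≤ (c / a) ^ (p - 1) := by
  have hLq : L ^ (q - 1) ≤ c / a := by
    rwa [le_div_iff₀' ha, ← le_div_iff₀ (by positivity), div_eq_mul_inv, ← Real.rpow_neg hL.le,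
      neg_sub]
  have hone : (q - 1) * (p - 1) = 1 := by linear_combination hpq.sub_one_mul_conj
  calc L = (L ^ (q - 1)) ^ (p - 1) := by rw [← Real.rpow_mul hL.le, hone, Real.rpow_one]
    _ ≤ (c / a) ^ (p - 1) := by
        have := hpq.sub_one_pos
        gcongr

lemma exists_log_le_of_integral_eq {p M β : ℝ} (hp : 1 < p) (hM : 0 < M) (hβ : 0 < β) :
    ∃ C > 0, ∀ (ε B : ℝ) (F h : ℝ → ℝ), 0 < ε → Real.exp 1 ≤ B →
      ContinuousOn F (Icc 1 B) → IntegrableOn h (Icc 1 B) →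
      (∀ᵐ t ∂volume.restrict (Icc 1 B), t ^ (-1 - p) * |F t| ^ p ≤ M * h t) →
      (∀ K η, IsLogCutoff p K B η →
        ε * β + ∫ t in 1..B, η t * h t = ∫ t in 1..B, F t * deriv (deriv η) t) →
      Real.log B ≤ C * ε ^ (-(p - 1)) := by
  have hpq := Real.HolderConjugate.conjExponent hp
  set q := p.conjExponent
  obtain ⟨K, hK, hcutoff⟩ := exists_isLogCutoff hp
  obtain ⟨C, hC, hyoung⟩ := exists_mul_deriv_deriv_le hpq hK hM
  refine ⟨(C / β) ^ (p - 1), by positivity, fun ε B F h hε hB hF hh hFh hweak => ?_⟩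
  obtain ⟨η, hη⟩ := hcutoff B hB
  have hB1 : 1 ≤ B := (Real.one_le_exp zero_le_one).trans hB
  have hB0 : 0 < B := by positivity
  have hL : 0 < Real.log B := zero_lt_one.trans_le ((Real.le_log_iff_exp_le hB0).2 hB)
  have hη'' : Continuous (deriv (deriv η)) :=
    (contDiff_infty.1 hη.contDiff 2).deriv'.continuous_deriv le_rfl
  have hηh : IntervalIntegrable (fun t => η t * h t) volume 1 B := by
    rw [intervalIntegrable_iff_integrableOn_Icc_of_le hB1]
    exact hh.continuousOn_mul hη.contDiff.continuous.continuousOn isCompact_Icc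
  have hinv : IntervalIntegrable (fun t : ℝ => C * Real.log B ^ (-q) * t⁻¹) volume 1 B := by
    refine ContinuousOn.intervalIntegrable_of_Icc hB1
      (continuousOn_const.mul (continuousOn_id.inv₀ fun t ht => ?_))
    exact (zero_lt_one.trans_le ht.1).ne'
  have hle : ∫ t in 1..B, F t * deriv (deriv η) t ≤
      ∫ t in 1..B, (η t * h t + C * Real.log B ^ (-q) * t⁻¹) := by
    refine intervalIntegral.integral_mono_ae_restrict hB1
      ((hF.mul hη''.continuousOn).intervalIntegrable_of_Icc hB1) (hηh.add hinv) ?_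
    filter_upwards [hFh, ae_restrict_mem measurableSet_Icc] with t hFht ht
    exact hyoung B η hB1 hη t (F t) (h t) ht.1 hFht
  rw [← hweak K η hη, intervalIntegral.integral_add hηh hinv, intervalIntegral.integral_const_mul,
    integral_inv_of_pos one_pos hB0, div_one, mul_assoc, ← Real.rpow_add_one hL.ne'] at hle
  have hbound : ε * β ≤ C * Real.log B ^ (1 - q) := by
    rw [sub_eq_neg_add]
    linarith
  refine (le_rpow_of_mul_le_mul_rpow hpq (by positivity) hL hbound).trans_eq ?_
  rw [div_mul_eq_div_div_swap, Real.div_rpow (by positivity) hε.le, Real.rpow_neg hε.le,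
    div_eq_mul_inv]

end LogBound

section Support

lemma A_eq {k t : ℝ} (hk : k < 1) : A k t = (t ^ (1 - k) - 1) / (1 - k) := by
  rw [A, integral_rpow (Or.inl (by linarith)), Real.one_rpow, show -k + 1 = 1 - k by ring]

lemma A_le_A {k s t : ℝ} (hk : k < 1) (hs : 1 ≤ s) (hst : s ≤ t) : A k s ≤ A k t := by
  have : 0 < 1 - k := by linarith
  rw [A_eq hk, A_eq hk]
  gcongr

lemma A_nonneg {k t : ℝ} (hk : k < 1) (ht : 1 ≤ t) : 0 ≤ A k t :=
  intervalIntegral.integral_same.symm.trans_le (A_le_A hk le_rfl ht)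

lemma A_add_le {k R t : ℝ} (hk : k < 1) (hR : 0 ≤ R) (ht : 1 ≤ t) :
    A k t + R ≤ (1 / (1 - k) + R) * t ^ (1 - k) := by
  have h0 : 0 < 1 - k := by linarith
  have h1 : 1 ≤ t ^ (1 - k) := Real.one_le_rpow ht h0.le
  have h2 : 0 < 1 / (1 - k) := by positivity
  rw [A_eq hk, add_mul, sub_div, one_div_mul_eq_div]
  linarith [le_mul_of_one_le_right hR h1]

lemma exists_volume_closedBall_rpow_le {n : ℕ} {k p R : ℝ} (hk : k < 1) (hp : 1 < p)
    (hnp : (1 - k) * n * (p - 1) ≤ 2) (hR : 0 ≤ R) :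
    ∃ M > 0, ∀ t, 1 ≤ t →
      volume.real (Metric.closedBall (0 : Space n) (A k t + R)) ^ (p - 1) ≤ M * t ^ (2 : ℝ) := by
  have : 0 < 1 - k := by linarith
  have : 0 < p - 1 := by linarith
  set V := volume.real (Metric.ball (0 : Space n) 1)
  have hV : 0 < V :=
    ENNReal.toReal_pos (Metric.measure_ball_pos _ _ one_pos).ne' measure_ball_lt_top.ne
  set c := 1 / (1 - k) + R
  have : 0 < c := by positivity
  refine ⟨(c ^ n * V) ^ (p - 1), by positivity, fun t ht => ?_⟩
  have ht0 : 0 < t := by positivity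
  have hA := A_nonneg hk ht
  have hpow : ((t ^ (1 - k)) ^ n) ^ (p - 1) ≤ t ^ (2 : ℝ) := by
    rw [← Real.rpow_natCast, ← Real.rpow_mul ht0.le, ← Real.rpow_mul ht0.le]
    exact Real.rpow_le_rpow_of_exponent_le ht hnp
  calc volume.real (Metric.closedBall (0 : Space n) (A k t + R)) ^ (p - 1)
      = ((A k t + R) ^ n * V) ^ (p - 1) := by
        rw [Measure.addHaar_real_closedBall _ _ (by positivity), finrank_euclideanSpace_fin]
    _ ≤ ((c * t ^ (1 - k)) ^ n * V) ^ (p - 1) := by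
        gcongr
        exact A_add_le hk hR ht
    _ = (c ^ n * V) ^ (p - 1) * ((t ^ (1 - k)) ^ n) ^ (p - 1) := by
        rw [← Real.mul_rpow (by positivity) (by positivity), mul_pow]
        ring_nf
    _ ≤ (c ^ n * V) ^ (p - 1) * t ^ (2 : ℝ) := by gcongr

lemma rpow_abs_integral_le {α : Type*} [MeasurableSpace α] {μ : Measure α} [IsFiniteMeasure μ]
    {p : ℝ} (hp : 1 < p) {f : α → ℝ} (hf : AEStronglyMeasurable f μ)
    (hint : Integrable (fun x => |f x| ^ p) μ) :
    |∫ x, f x ∂μ| ^ p ≤ μ.real univ ^ (p - 1) * ∫ x, |f x| ^ p ∂μ := by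
  have hpq := Real.HolderConjugate.conjExponent hp
  have hp0 := hpq.pos
  have hfL : MemLp f (ENNReal.ofReal p) μ := by
    rw [← integrable_norm_rpow_iff hf (ENNReal.ofReal_pos.2 hp0).ne' ENNReal.ofReal_ne_top,
      ENNReal.toReal_ofReal hp0.le]
    exact hint
  have hH := integral_mul_norm_le_Lp_mul_Lq (g := fun _ => (1 : ℝ)) hpq hfL (memLp_const 1)
  simp only [norm_one, mul_one, Real.one_rpow, integral_const, smul_eq_mul,
    Real.norm_eq_abs] at hH
  have hI : 0 ≤ ∫ x, |f x| ^ p ∂μ := integral_nonneg fun x => by positivity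
  calc |∫ x, f x ∂μ| ^ p ≤ (∫ x, |f x| ∂μ) ^ p := by
        gcongr
        exact abs_integral_le_integral_abs
    _ ≤ ((∫ x, |f x| ^ p ∂μ) ^ (1 / p) * μ.real univ ^ (1 / p.conjExponent)) ^ p :=
        Real.rpow_le_rpow (integral_nonneg fun x => abs_nonneg _) hH hp0.le
    _ = μ.real univ ^ (p - 1) * ∫ x, |f x| ^ p ∂μ := by
        rw [Real.mul_rpow (by positivity) (by positivity), ← Real.rpow_mul hI,
          ← Real.rpow_mul measureReal_nonneg, one_div_mul_cancel hp0.ne', Real.rpow_one, mul_comm,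
          one_div_mul_eq_div, hpq.div_conj_eq_sub_one]

lemma SupportedInBall.comp_mul_ae_eq {n : ℕ} {f : L2 n} {r : ℝ} (hf : SupportedInBall f r)
    {φ : Space n → ℝ} (hφ : ∀ x ∈ Metric.closedBall 0 r, φ x = 1) {g : ℝ → ℝ} (hg : g 0 = 0) :
    (fun x => g (f x) * φ x) =ᵐ[volume] fun x => g (f x) := by
  filter_upwards [hf] with x hx
  rcases lt_or_ge r ‖x‖ with h | h
  · rw [hx h, hg, zero_mul]
  · rw [hφ x (mem_closedBall_zero_iff.2 h), mul_one]

lemma SupportedInBall.setIntegral_comp_eq {n : ℕ} {f : L2 n} {r : ℝ} (hf : SupportedInBall f r)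
    {g : ℝ → ℝ} (hg : g 0 = 0) :
    ∫ x in Metric.closedBall 0 r, g (f x) = ∫ x, g (f x) := by
  refine setIntegral_eq_integral_of_ae_compl_eq_zero ?_
  filter_upwards [hf] with x hx hxr
  rw [hx (not_le.1 (mem_closedBall_zero_iff.not.1 hxr)), hg]

lemma SupportedInBall.rpow_abs_integral_le {n : ℕ} {p r : ℝ} (hp : 1 < p) {f : L2 n}
    (hf : SupportedInBall f r) (hint : Integrable fun x => |f x| ^ p) :
    |∫ x, f x| ^ p ≤
      volume.real (Metric.closedBall (0 : Space n) r) ^ (p - 1) * ∫ x, |f x| ^ p := by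
  have hf1 : ∫ x in Metric.closedBall 0 r, f x = ∫ x, f x := hf.setIntegral_comp_eq (g := id) rfl
  have : IsFiniteMeasure (volume.restrict (Metric.closedBall (0 : Space n) r)) :=
    ⟨by simpa only [Measure.restrict_apply_univ] using measure_closedBall_lt_top⟩
  have h := EdeS.rpow_abs_integral_le (μ := volume.restrict (Metric.closedBall (0 : Space n) r))
    hp (Lp.aestronglyMeasurable f).restrict hint.restrict
  rwa [measureReal_restrict_apply_univ, hf1,
    hf.setIntegral_comp_eq (g := fun y => |y| ^ p)
      (by rw [abs_zero, Real.zero_rpow (by positivity)])] at h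

lemma SupportedInBall.integral_pos {n : ℕ} {f : L2 n} {r : ℝ} (hf : SupportedInBall f r)
    (hnn : ∀ᵐ x, 0 ≤ f x) (hne : f ≠ 0) : 0 < ∫ x, f x := by
  have hball : IntegrableOn f (Metric.closedBall (0 : Space n) r) :=
    ((Lp.memLp f).locallyIntegrable one_le_two).integrableOn_isCompact (isCompact_closedBall 0 r)
  have hint : Integrable f volume := by
    refine hball.integrable_of_ae_notMem_eq_zero ?_
    filter_upwards [hf] with x hx hxr
    exact hx (not_le.1 (mem_closedBall_zero_iff.not.1 hxr))
  refine (integral_nonneg_of_ae hnn).lt_of_ne fun h => hne ?_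
  exact Lp.eq_zero_iff_ae_eq_zero.2 ((integral_eq_zero_iff_of_nonneg_ae hnn hint).1 h.symm)

lemma exists_rpow_abs_integral_le {n : ℕ} {k p R : ℝ} (hk : k < 1) (hp : 1 < p)
    (hnp : (1 - k) * n * (p - 1) ≤ 2) (hR : 0 ≤ R) :
    ∃ M > 0, ∀ (t : ℝ) (f : L2 n) (φ : Space n → ℝ), 1 ≤ t → SupportedInBall f (A k t + R) →
      (∀ x ∈ Metric.closedBall 0 (A k t + R), φ x = 1) →
      Integrable (fun x => |f x| ^ p * φ x) →
        t ^ (-1 - p) * |∫ x, f x * φ x| ^ p ≤ M * ∫ x, t ^ (1 - p) * |f x| ^ p * φ x := by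
  obtain ⟨M, hM, hvol⟩ := exists_volume_closedBall_rpow_le hk hp hnp hR
  refine ⟨M, hM, fun t f φ ht hf hφ hint => ?_⟩
  have ht0 : 0 < t := by positivity
  have hfp := hf.comp_mul_ae_eq hφ (g := fun y => |y| ^ p)
    (by rw [abs_zero, Real.zero_rpow (by positivity)])
  have hf1 : (fun x => f x * φ x) =ᵐ[volume] f := hf.comp_mul_ae_eq hφ (g := id) rfl
  have hI : 0 ≤ ∫ x, |f x| ^ p := integral_nonneg fun x => by positivity
  simp only [mul_assoc (t ^ (1 - p)), integral_const_mul]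
  rw [integral_congr_ae hf1, integral_congr_ae hfp]
  calc t ^ (-1 - p) * |∫ x, f x| ^ p
      ≤ t ^ (-1 - p) * (M * t ^ (2 : ℝ) * ∫ x, |f x| ^ p) := by
        gcongr
        exact (hf.rpow_abs_integral_le hp (hint.congr hfp)).trans
          (mul_le_mul_of_nonneg_right (hvol t ht) hI)
    _ = M * (t ^ (-1 - p + 2) * ∫ x, |f x| ^ p) := by rw [Real.rpow_add ht0]; ring
    _ = M * (t ^ (1 - p) * ∫ x, |f x| ^ p) := by ring_nf

end Support

section WeakFormulation

lemma inner_gradient_eq_sum {n : ℕ} (v : Space n) (φ : Space n → ℝ) (x : Space n) :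
    inner ℝ v (∇ φ x) = ∑ i, v i * fderiv ℝ φ x (EuclideanSpace.single i 1) := by
  have hcoord : ∀ i, ∇ φ x i = fderiv ℝ φ x (EuclideanSpace.single i 1) := fun i => by
    rw [← inner_gradient_left, EuclideanSpace.inner_single_right, one_mul, conj_trivial]
  simp only [PiLp.inner_apply, RCLike.inner_apply, conj_trivial, hcoord, mul_comm]

lemma integrable_inner_gradient {n : ℕ} (g : L2Vec n) {φ : Space n → ℝ} (hφ : ContDiff ℝ ∞ φ)
    (hc : HasCompactSupport φ) : Integrable fun x => inner ℝ (g x) (∇ φ x) := by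
  simp only [inner_gradient_eq_sum]
  exact integrable_finsetSum _ fun i _ => integrable_mul_test (memLp_coord g i)
    (continuous_partial hφ i) (hasCompactSupport_partial hc i)

lemma SupportedInBall.integral_inner_gradient_eq_zero {n : ℕ} {u : H1 n} {r a : ℝ}
    (hu : SupportedInBall u.fn r) {φ : Space n → ℝ} (hφ : ContDiff ℝ ∞ φ)
    (hc : HasCompactSupport φ) (hφa : ∀ x ∈ Metric.closedBall 0 r, φ =ᶠ[𝓝 x] fun _ => a) :
    ∫ x, inner ℝ (u.grad x) (∇ φ x) = 0 := by
  have hterm : ∀ i : Fin n,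
      ∫ x, u.grad x i * fderiv ℝ φ x (EuclideanSpace.single i 1) = 0 := by
    intro i
    set dφ : Space n → ℝ := fun x => fderiv ℝ φ x (EuclideanSpace.single i 1)
    have hsmooth : ContDiff ℝ ∞ dφ :=
      (hφ.fderiv_right (m := ∞) (by simp)).clm_apply contDiff_const
    have hflat : ∀ x ∈ Metric.closedBall 0 r, fderiv ℝ dφ x = 0 := fun x hx => by
      have h : dφ =ᶠ[𝓝 x] fun _ => 0 := by
        filter_upwards [(hφa x hx).fderiv (𝕜 := ℝ)] with y hy
        simp only [dφ, hy, fderiv_fun_const, Pi.zero_apply, zero_apply]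
      rw [h.fderiv_eq, fderiv_const_apply]
    have hfn : ∫ x, u.fn x * fderiv ℝ dφ x (EuclideanSpace.single i 1) = 0 := by
      refine integral_eq_zero_of_ae ?_
      filter_upwards [hu] with x hx
      rcases lt_or_ge r ‖x‖ with h | h
      · rw [hx h, zero_mul, Pi.zero_apply]
      · rw [hflat x (mem_closedBall_zero_iff.2 h), zero_apply, mul_zero,
          Pi.zero_apply]
    have hweak := u.2 dφ hsmooth (hasCompactSupport_partial hc i) i
    exact neg_eq_zero.1 (hweak.symm.trans hfn)
  simp only [inner_gradient_eq_sum]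
  rw [integral_finsetSum _ fun i _ => integrable_mul_test (memLp_coord u.grad i)
    (continuous_partial hφ i) (hasCompactSupport_partial hc i)]
  exact Finset.sum_eq_zero fun i _ => hterm i

lemma SupportedInBall.integral_inner_gradient_bump_eq_zero {n : ℕ} {u : H1 n} {r c : ℝ}
    (hu : SupportedInBall u.fn r) {φ : ContDiffBump (0 : Space n)} (hφ : r < φ.rIn) :
    ∫ x, inner ℝ (u.grad x) (∇ (fun y => c * φ y) x) = 0 := by
  refine hu.integral_inner_gradient_eq_zero (contDiff_const.mul φ.contDiff)
    φ.hasCompactSupport.mul_left (a := c) fun x hx => ?_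
  filter_upwards [φ.eventuallyEq_one_of_mem_ball (Metric.closedBall_subset_ball hφ hx)] with y hy
  rw [hy, Pi.one_apply, mul_one]

/-- The functional `f ↦ ∫ f φ` on `L²(ℝⁿ)` given by a test function `φ`. It turns derivatives of
curves in `L²` into derivatives of real functions. -/
noncomputable def pairing {n : ℕ} {φ : Space n → ℝ} (hφ : Continuous φ)
    (hc : HasCompactSupport φ) : L2 n →L[ℝ] ℝ :=
  innerSL ℝ ((hφ.memLp_of_hasCompactSupport (μ := volume) (p := 2) hc).toLp φ)

lemma pairing_apply {n : ℕ} {φ : Space n → ℝ} (hφ : Continuous φ) (hc : HasCompactSupport φ)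
    (f : L2 n) : pairing hφ hc f = ∫ x, f x * φ x := by
  rw [pairing, innerSL_apply_apply, L2.inner_def]
  refine integral_congr_ae ?_
  filter_upwards [(hφ.memLp_of_hasCompactSupport (μ := volume) (p := 2) hc).coeFn_toLp] with x hx
  rw [hx, RCLike.inner_apply, conj_trivial]

lemma isTestFunction_mul {n : ℕ} {T : EReal} {η : ℝ → ℝ} {φ : Space n → ℝ}
    (hη : ContDiff ℝ ∞ η) (hηc : HasCompactSupport η) (hηT : ∀ t ∈ tsupport η, (t : EReal) < T)
    (hφ : ContDiff ℝ ∞ φ) (hφc : HasCompactSupport φ) :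
    IsTestFunction T fun z : ℝ × Space n => η z.1 * φ z.2 := by
  have hsub : tsupport (fun z : ℝ × Space n => η z.1 * φ z.2) ⊆ tsupport η ×ˢ tsupport φ :=
    closure_minimal (fun z hz => ⟨subset_tsupport _ (left_ne_zero_of_mul hz),
      subset_tsupport _ (right_ne_zero_of_mul hz)⟩)
      ((isClosed_tsupport _).prod (isClosed_tsupport _))
  exact ⟨(hη.comp contDiff_fst).mul (hφ.comp contDiff_snd),
    (hηc.prod hφc).of_isClosed_subset (isClosed_tsupport _) hsub, fun z hz => hηT _ (hsub hz).1⟩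

lemma mem_timeInterval {T : EReal} {B t : ℝ} (hBT : (B : EReal) < T) (ht : t ∈ Icc 1 B) :
    t ∈ timeInterval T :=
  ⟨ht.1, (EReal.coe_le_coe_iff.2 ht.2).trans_lt hBT⟩

lemma timeInterval_eq_inter (T : EReal) :
    timeInterval T = Ici 1 ∩ (fun t : ℝ => (t : EReal)) ⁻¹' Iio T := rfl

lemma uniqueDiffOn_timeInterval (T : EReal) : UniqueDiffOn ℝ (timeInterval T) := by
  rw [timeInterval_eq_inter]
  exact (uniqueDiffOn_Ici 1).inter (isOpen_Iio.preimage continuous_coe_real_ereal)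

lemma timeInterval_mem_nhds {T : EReal} {t : ℝ} (ht : 1 < t) (htT : (t : EReal) < T) :
    timeInterval T ∈ 𝓝 t := by
  rw [timeInterval_eq_inter]
  exact Filter.inter_mem (Ici_mem_nhds ht)
    ((isOpen_Iio.preimage continuous_coe_real_ereal).mem_nhds htT)

variable {n : ℕ} {k p ε R B : ℝ} {u₀ : H1 n} {u₁ : L2 n} {T : EReal} {u : ℝ → H1 n}

lemma IsEnergySolution.hasDerivAt_fn (hu : IsEnergySolution k p ε u₀ u₁ T u) {t : ℝ} (ht : 1 < t)
    (htT : (t : EReal) < T) : HasDerivAt (fun s => (u s).fn) (timeDeriv T u t) t :=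
  (hu.contDiff_L2.differentiableOn one_ne_zero t ⟨ht.le, htT⟩).hasDerivWithinAt.hasDerivAt
    (timeInterval_mem_nhds ht htT)

lemma IsEnergySolution.continuousOn_timeDeriv (hu : IsEnergySolution k p ε u₀ u₁ T u) :
    ContinuousOn (timeDeriv T u) (timeInterval T) :=
  hu.contDiff_L2.continuousOn_derivWithin (uniqueDiffOn_timeInterval T) le_rfl

lemma IsEnergySolution.integral_test_eq (hu : IsEnergySolution k p ε u₀ u₁ T u)
    (hcone : HasConeSupport k R T u) (hk : k < 1) (hB : 1 < B) (hBT : (B : EReal) < T)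
    {K : ℝ} {η : ℝ → ℝ} (hη : IsLogCutoff p K B η) {φ : ContDiffBump (0 : Space n)}
    (hφ : A k B + R < φ.rIn) :
    ε * (∫ x, u₁ x * φ x) + ∫ s in 1..B, η s * ∫ x, s ^ (1 - p) * |(u s).fn x| ^ p * φ x =
      -∫ s in 1..B, deriv η s * ∫ x, timeDeriv T u s x * φ x := by
  have htest : IsTestFunction T fun z : ℝ × Space n => η z.1 * φ z.2 :=
    isTestFunction_mul hη.contDiff hη.hasCompactSupport
      (fun t ht => (EReal.coe_le_coe_iff.2 ((le_abs_self t).trans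
        (hη.abs_le_of_mem_tsupport ht))).trans_lt hBT) φ.contDiff φ.hasCompactSupport
  have hη1 : η 1 = 1 := hη.eventuallyEq_one.eq_of_nhds
  have hηB : η B = 0 := hη.eq_zero B (le_abs_self B)
  have hinner : ∀ s ∈ Ioc 1 B, ∫ x, (timeDeriv T u s x * deriv (fun r => η r * φ x) s -
      s ^ (-2 * k) * inner ℝ ((u s).grad x) (∇ (fun y => η s * φ y) x)) =
      deriv η s * ∫ x, timeDeriv T u s x * φ x := by
    intro s hs
    have hderiv : ∀ x, timeDeriv T u s x * deriv (fun r => η r * φ x) s =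
        deriv η s * (timeDeriv T u s x * φ x) := fun x => by
      rw [deriv_mul_const (hη.contDiff.differentiable (by simp) s)]
      ring
    simp only [hderiv]
    rw [integral_sub ((integrable_mul_test (Lp.memLp _) φ.continuous
        φ.hasCompactSupport).const_mul _)
      ((integrable_inner_gradient _ (contDiff_const.mul φ.contDiff)
        φ.hasCompactSupport.mul_left).const_mul _), integral_const_mul, integral_const_mul,
      (hcone s hs.1 (mem_timeInterval hBT (Ioc_subset_Icc_self hs)).2
        ).integral_inner_gradient_bump_eq_zero
          ((add_le_add_left (A_le_A hk hs.1.le hs.2) R).trans_lt hφ),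
      mul_zero, sub_zero]
  have hnonlin : ∀ s, ∫ x, s ^ (1 - p) * |(u s).fn x| ^ p * (η s * φ x) =
      η s * ∫ x, s ^ (1 - p) * |(u s).fn x| ^ p * φ x := fun s => by
    rw [← integral_const_mul]
    simp only [mul_left_comm]
  have hweak := hu.integral_eq _ htest B hB hBT
  simp only [hη1, hηB, zero_mul, mul_zero, one_mul, integral_zero, hnonlin] at hweak
  rw [intervalIntegral.integral_congr_ae (g := fun s => deriv η s * ∫ x, timeDeriv T u s x * φ x)
    (Filter.Eventually.of_forall fun s hs => hinner s (by rwa [uIoc_of_le hB.le] at hs))] at hweak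
  linarith

lemma IsEnergySolution.integral_deriv_mul_eq (hu : IsEnergySolution k p ε u₀ u₁ T u)
    (hB : 1 ≤ B) (hBT : (B : EReal) < T) {K : ℝ} {η : ℝ → ℝ} (hη : IsLogCutoff p K B η)
    (ℓ : L2 n →L[ℝ] ℝ) :
    ∫ s in 1..B, deriv η s * ℓ (timeDeriv T u s) =
      -∫ s in 1..B, ℓ (u s).fn * deriv (deriv η) s := by
  have hη' : ContDiff ℝ 1 (deriv η) := (contDiff_infty.1 hη.contDiff 2).deriv'
  have hsub : Icc 1 B ⊆ timeInterval T := fun t ht => mem_timeInterval hBT ht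
  have hℓ : ContinuousOn (fun s => ℓ (timeDeriv T u s)) (Icc 1 B) :=
    ℓ.continuous.comp_continuousOn (hu.continuousOn_timeDeriv.mono hsub)
  have hparts := intervalIntegral.integral_mul_deriv_eq_deriv_mul_of_hasDerivAt (a := 1) (b := B)
    (u := deriv η) (v := fun s => ℓ (u s).fn) (u' := deriv (deriv η))
    (v' := fun s => ℓ (timeDeriv T u s)) hη'.continuous.continuousOn
    (by
      rw [uIcc_of_le hB]
      exact ℓ.continuous.comp_continuousOn (hu.contDiff_L2.continuousOn.mono hsub))
    (fun s _ => (hη'.differentiable one_ne_zero s).hasDerivAt)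
    (fun s hs => by
      rw [min_eq_left hB, max_eq_right hB] at hs
      exact ℓ.hasFDerivAt.comp_hasDerivAt s
        (hu.hasDerivAt_fn hs.1 (hsub (Ioo_subset_Icc_self hs)).2))
    ((hη'.continuous_deriv le_rfl).intervalIntegrable _ _) (hℓ.intervalIntegrable_of_Icc hB)
  rw [hparts, hη.deriv_one, hη.deriv_right]
  simp only [zero_mul, sub_zero, zero_sub, mul_comm]

end WeakFormulation

section Blowup

lemma integrable_rpow_mul_prod {n : ℕ} {p B : ℝ} (hp : 0 < p) {U : ℝ × Space n → ℝ}
    {φ : Space n → ℝ} (hφ : Continuous φ) (hφc : HasCompactSupport φ)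
    (hU : MemLp U (ENNReal.ofReal p) (volume.restrict (Icc 1 B ×ˢ tsupport φ))) :
    Integrable (fun z : ℝ × Space n => z.1 ^ (1 - p) * |U z| ^ p * φ z.2)
      ((volume.restrict (Icc 1 B)).prod volume) := by
  have hpow : IntegrableOn (fun z => |U z| ^ p) (Icc 1 B ×ˢ tsupport φ) := by
    have h := hU.integrable_norm_rpow (ENNReal.ofReal_pos.2 hp).ne' ENNReal.ofReal_ne_top
    rwa [ENNReal.toReal_ofReal hp.le] at h
  have hweight : ContinuousOn (fun z : ℝ × Space n => z.1 ^ (1 - p) * φ z.2)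
      (Icc 1 B ×ˢ tsupport φ) :=
    (continuousOn_fst.rpow_const fun z hz => Or.inl (zero_lt_one.trans_le hz.1.1).ne').mul
      (hφ.comp continuous_snd).continuousOn
  have hint := hpow.mul_continuousOn hweight (isCompact_Icc.prod hφc)
  have hprod : ((volume : Measure ℝ).restrict (Icc 1 B)).prod (volume : Measure (Space n)) =
      volume.restrict (Icc 1 B ×ˢ univ) := by
    rw [Measure.volume_eq_prod, ← Measure.prod_restrict, Measure.restrict_univ]
  rw [hprod]
  refine IntegrableOn.of_forall_sdiff_eq_zero (s := Icc 1 B ×ˢ tsupport φ) ?_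
    (measurableSet_Icc.prod MeasurableSet.univ) fun z hz => ?_
  · refine hint.congr (Filter.Eventually.of_forall fun z => ?_)
    ring
  · rw [image_eq_zero_of_notMem_tsupport fun h => hz.2 ⟨hz.1.1, h⟩, mul_zero]

lemma MemLpLoc.integrable_nonlinearity {n : ℕ} {p B : ℝ} {T : EReal} {u : ℝ → H1 n}
    (hu : MemLpLoc p T u) (hp : 0 < p) (hBT : (B : EReal) < T) {φ : Space n → ℝ}
    (hφ : Continuous φ) (hφc : HasCompactSupport φ) :
    IntegrableOn (fun s => ∫ x, s ^ (1 - p) * |(u s).fn x| ^ p * φ x) (Icc 1 B) ∧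
      ∀ᵐ s ∂volume.restrict (Icc 1 B), Integrable fun x => |(u s).fn x| ^ p * φ x := by
  obtain ⟨U, hUu, hU⟩ := hu
  have hint := integrable_rpow_mul_prod hp hφ hφc (hU _ (isCompact_Icc.prod hφc)
    (prod_mono (fun t ht => mem_timeInterval hBT ht) (subset_univ _)))
  have hslice : ∀ᵐ s ∂volume.restrict (Icc 1 B),
      (fun x => s ^ (1 - p) * |U (s, x)| ^ p * φ x) =ᵐ[volume]
        fun x => s ^ (1 - p) * |(u s).fn x| ^ p * φ x := by
    filter_upwards [ae_restrict_of_ae hUu, ae_restrict_mem measurableSet_Icc] with s hs hsB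
    filter_upwards [hs (mem_timeInterval hBT hsB)] with x hx
    rw [hx]
  constructor
  · refine hint.integral_prod_left.congr ?_
    filter_upwards [hslice] with s hs using integral_congr_ae hs
  · filter_upwards [hslice, hint.prod_right_ae, ae_restrict_mem measurableSet_Icc] with s hs hi hsB
    have hs0 : s ^ (1 - p) ≠ 0 := (Real.rpow_pos_of_pos (zero_lt_one.trans_le hsB.1) _).ne'
    refine (integrable_const_mul_iff hs0.isUnit _).1 ((hi.congr hs).congr ?_)
    exact Filter.Eventually.of_forall fun x => mul_assoc _ _ _

lemma exists_log_le_of_isEnergySolution {n : ℕ} {k p R : ℝ} (hk : k < 1) (hp : 1 < p)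
    (hnp : (1 - k) * n * (p - 1) ≤ 2) (hR : 0 ≤ R) (u₀ : H1 n) {u₁ : L2 n}
    (hu₁ : 0 < ∫ x, u₁ x) (hu₁_supp : SupportedInBall u₁ R) :
    ∃ C > 0, ∀ (ε B : ℝ) (T : EReal) (u : ℝ → H1 n), 0 < ε → IsEnergySolution k p ε u₀ u₁ T u →
      HasConeSupport k R T u → Real.exp 1 ≤ B → (B : EReal) < T →
        Real.log B ≤ C * ε ^ (-(p - 1)) := by
  obtain ⟨M, hM, hlower⟩ := exists_rpow_abs_integral_le hk hp hnp hR
  obtain ⟨C, hC, hbound⟩ := exists_log_le_of_integral_eq hp hM hu₁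
  refine ⟨C, hC, fun ε B T u hε hu hcone hB hBT => ?_⟩
  have hB1 : 1 < B := (Real.one_lt_exp_iff.2 one_pos).trans_le hB
  have hAB := A_nonneg hk hB1.le
  let φ : ContDiffBump (0 : Space n) :=
    ⟨A k B + R + 1, A k B + R + 2, by positivity, by linarith⟩
  have hφ1 : ∀ r ≤ A k B + R, ∀ x ∈ Metric.closedBall 0 r, φ x = 1 := fun r hr x hx =>
    φ.one_of_mem_closedBall (Metric.closedBall_subset_closedBall
      (hr.trans (le_add_of_nonneg_right zero_le_one)) hx)
  obtain ⟨hint, hslice⟩ := hu.memLpLoc.integrable_nonlinearity (by positivity) hBT φ.continuous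
    φ.hasCompactSupport
  have hu₁φ : ∫ x, u₁ x * φ x = ∫ x, u₁ x :=
    integral_congr_ae (hu₁_supp.comp_mul_ae_eq (hφ1 R (by linarith)) (g := id) rfl)
  set ℓ := pairing φ.continuous φ.hasCompactSupport
  refine hbound ε B (fun s => ℓ (u s).fn) _ hε hB ?_ hint ?_ fun K η hη => ?_
  · exact ℓ.continuous.comp_continuousOn
      (hu.contDiff_L2.continuousOn.mono fun t ht => mem_timeInterval hBT ht)
  · have hne : ∀ᵐ s ∂volume.restrict (Icc 1 B), s ≠ 1 :=
      ae_restrict_of_ae (compl_mem_ae_iff.2 (measure_singleton 1))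
    filter_upwards [hslice, hne, ae_restrict_mem measurableSet_Icc] with s hs hs1 hsB
    rw [pairing_apply]
    have hA := A_le_A hk hsB.1 hsB.2
    exact hlower s (u s).fn φ hsB.1
      (hcone s (hsB.1.lt_of_ne' hs1) (mem_timeInterval hBT hsB).2) (hφ1 _ (by linarith)) hs
  · rw [← hu₁φ, hu.integral_test_eq hcone hk hB1 hBT hη (lt_add_one (A k B + R))]
    simp only [← pairing_apply φ.continuous φ.hasCompactSupport]
    rw [hu.integral_deriv_mul_eq hB1.le hBT hη, neg_neg]

end Blowup

lemma one_lt_p₁ {n : ℕ} {k : ℝ} (hn : 1 ≤ n) (hk : k < 1) : 1 < p₁ n k := by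
  have : 0 < 1 - k := by linarith
  rw [p₁]
  exact lt_add_of_pos_right _ (by positivity)

lemma mul_p₁_sub_one {n : ℕ} {k : ℝ} (hn : 1 ≤ n) (hk : k < 1) :
    (1 - k) * n * (p₁ n k - 1) = 2 := by
  have : 1 - k ≠ 0 := by linarith
  rw [p₁]
  field_simp
  ring

end EdeS

/-- `(1 - k) * n * (p - 1) ≤ 2` is `p ≤ p₁ n k`, written without the division by `n`. -/
theorem theorem1p2_general {n : ℕ} {k p R : ℝ} (hk : k < 1) (hp : 1 < p)
    (hnp : (1 - k) * n * (p - 1) ≤ 2) (hR : 0 ≤ R) (u₀ : EdeS.H1 n) {u₁ : EdeS.L2 n}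
    (hu₁ : 0 < ∫ x, u₁ x) (hu₁_supp : EdeS.SupportedInBall u₁ R) :
    ∃ ε₀ > 0, ∃ C > 0, ∀ ε : ℝ, 0 < ε → ε ≤ ε₀ →
      (∀ (T : EReal) (u : ℝ → EdeS.H1 n), EdeS.IsEnergySolution k p ε u₀ u₁ T u →
        EdeS.HasConeSupport k R T u →
          T < ⊤ ∧ T ≤ ((Real.exp (C * ε ^ (-(p - 1))) : ℝ) : EReal)) ∧
      EdeS.lifespan k p R u₀ u₁ ε ≤ ((Real.exp (C * ε ^ (-(p - 1))) : ℝ) : EReal) := by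
  obtain ⟨C, hC, hlog⟩ := EdeS.exists_log_le_of_isEnergySolution hk hp hnp hR u₀ hu₁ hu₁_supp
  refine ⟨1, one_pos, max C 1, by positivity, fun ε hε hε1 => ?_⟩
  have hbound : ∀ (T : EReal) (u : ℝ → EdeS.H1 n), EdeS.IsEnergySolution k p ε u₀ u₁ T u →
      EdeS.HasConeSupport k R T u → T ≤ (Real.exp (max C 1 * ε ^ (-(p - 1))) : ℝ) := by
    intro T u hu hcone
    by_contra! hlt
    obtain ⟨B, hB, hBT⟩ := EReal.lt_iff_exists_real_btwn.1 hlt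
    rw [EReal.coe_lt_coe_iff] at hB
    have hε' : 1 ≤ ε ^ (-(p - 1)) :=
      Real.one_le_rpow_of_pos_of_le_one_of_nonpos hε hε1 (by linarith)
    have hexp : Real.exp 1 ≤ B :=
      (Real.exp_le_exp.2 (one_le_mul_of_one_le_of_one_le (le_max_right C 1) hε')).trans hB.le
    refine hB.not_ge ((Real.log_le_iff_le_exp ((Real.exp_pos 1).trans_le hexp)).1 ?_)
    exact (hlog ε B T u hε hu hcone hexp hBT).trans (by gcongr; exact le_max_left C 1)
  exact ⟨fun T u hu hcone => ⟨(hbound T u hu hcone).trans_lt (EReal.coe_lt_top _),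
    hbound T u hu hcone⟩, sSup_le fun T ⟨u, hu, hcone⟩ => hbound T u hu hcone⟩

theorem theorem1p2 (n : ℕ) (hn : 1 ≤ n) (k : ℝ) (hk0 : 0 ≤ k) (hk1 : k < 1)
    (hnN : (n : ℝ) ≤ EdeS.N k) (p : ℝ) (hp : p = EdeS.p₁ n k)
    (R : ℝ) (hR : 0 < R) (u₀ : EdeS.H1 n) (u₁ : EdeS.L2 n)
    (hu₀_nonneg : ∀ᵐ x : EdeS.Space n, 0 ≤ u₀.fn x)
    (hu₁_nonneg : ∀ᵐ x : EdeS.Space n, 0 ≤ u₁ x)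
    (hu₀_ne : u₀.fn ≠ 0) (hu₁_ne : u₁ ≠ 0)
    (hu₀_supp : EdeS.SupportedInBall u₀.fn R) (hu₁_supp : EdeS.SupportedInBall u₁ R) :
    ∃ ε₀ > 0, ∃ C > 0, ∀ ε : ℝ, 0 < ε → ε ≤ ε₀ →
      (∀ (T : EReal) (u : ℝ → EdeS.H1 n), EdeS.IsEnergySolution k p ε u₀ u₁ T u →
        EdeS.HasConeSupport k R T u →
          T < ⊤ ∧ T ≤ ((Real.exp (C * ε ^ (-(p - 1))) : ℝ) : EReal)) ∧
      EdeS.lifespan k p R u₀ u₁ ε ≤ ((Real.exp (C * ε ^ (-(p - 1))) : ℝ) : EReal) := by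
  subst hp
  exact theorem1p2_general hk1 (EdeS.one_lt_p₁ hn hk1) (EdeS.mul_p₁_sub_one hn hk1).le hR.le u₀
    (hu₁_supp.integral_pos hu₁_nonneg hu₁_ne) hu₁_supp
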